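/- Let $\mathcal H_A,\mathcal H_B,\mathcal H_C$ be finite-dimensional complex Hilbert spaces and let $\rho_{ABC},\sigma_{ABC}$ be quantum states (positive semidefinite operators of trace one) on $\mathcal H_A\otimes\mathcal H_B\otimes\mathcal H_C$. Write $\rho_{AC}=\operatorname{Tr}_B\rho_{ABC}$, $\rho_{BC}=\operatorname{Tr}_A\rho_{ABC}$, $\rho_C=\operatorname{Tr}_{AB}\rho_{ABC}$, and similarly for $\sigma$. Then $$S\big(\rho_{ABC}\,\big\|\,\exp(\log\sigma_{AC}+\log\sigma_{BC}-\log\sigma_C)\big)\;\ge\; I(A:B|C)_\rho+\tfrac12 S(\rho_{AC}\|\sigma_{AC})+\tfrac12 S(\rho_{BC}\|\sigma_{BC}),$$ an inequality in $(-\infty,+\infty]$. Here $S(\rho)=-\operatorname{Tr}\rho\log\rho$ is the von Neumann entropy, $I(A:B|C)_\rho=S(\rho_{AC})+S(\rho_{BC})-S(\rho_{ABC})-S(\rho_C)$, and for positive semidefinite operators $S(\rho\|\sigma)=\operatorname{Tr}\rho(\log\rho-\log\sigma)$ if $\operatorname{supp}\rho\subseteq\operatorname{supp}\sigma$ and $S(\rho\|\sigma)=+\infty$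 otherwise. The logarithm of a positive semidefinite operator is taken on its support and set to zero on its kernel, and operators on $AC$, $BC$, $C$ act on $ABC$ tensored with the identity. If $\sigma_{AC}$ and $\sigma_{BC}$ are invertible, $\exp(\log\sigma_{AC}+\log\sigma_{BC}-\log\sigma_C)$ is the ordinary exponential. In general, let $V$ be the intersection of the supports of $\sigma_{AC}\otimes 1_B$ and $\sigma_{BC}\otimes 1_A$ in $\mathcal H_A\otimes\mathcal H_B\otimes\mathcal H_C$; then $\exp(\log\sigma_{AC}+\log\sigma_{BC}-\log\sigma_C)$ denotes the operator that on $V$ is the exponential of the compression of $\log\sigma_{AC}+\log\sigma_{BC}-\log\sigma_C$ to $V$, and that vanishes on $V^\perp$. -/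

import Mathlib

open scoped Matrix Kronecker ComplexOrder

noncomputable section

namespace QEntropy

variable {n a b c : Type*} [Fintype n] [DecidableEq n] [Fintype a] [DecidableEq a]
  [Fintype b] [DecidableEq b] [Fintype c] [DecidableEq c]

/-- A quantum state on `ℂⁿ`: a positive semidefinite matrix of trace one. -/
structure IsState (ρ : Matrix n n ℂ) : Prop where
  posSemidef : ρ.PosSemidef
  trace_eq_one : ρ.trace = 1

/-- The support of an operator: the orthogonal complement of its kernel. -/
def supp (X : Matrix n n ℂ) : Submodule ℂ (EuclideanSpace ℂ n) :=
  (LinearMap.ker (Matrix.toEuclideanLin X))ᗮ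

/-- The logarithm of a Hermitian matrix by functional calculus. Since `Real.log 0 = 0`, for a
positive semidefinite matrix this is the logarithm taken on the support (and zero on the kernel). -/
def mlog (X : Matrix n n ℂ) : Matrix n n ℂ := cfc Real.log X

/-- The matrix of the orthogonal projection onto a subspace. -/
def projMatrix (V : Submodule ℂ (EuclideanSpace ℂ n)) : Matrix n n ℂ :=
  Matrix.toEuclideanCLM (n := n) (𝕜 := ℂ) |>.symm V.starProjection

/-- The exponential of the compression of `H` to the subspace `V`, extended by zero on the
orthogonal complement of `V`. -/
def expOn (V : Submodule ℂ (EuclideanSpace ℂ n)) (H : Matrix n n ℂ) : Matrix n n ℂ :=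
  projMatrix V * NormedSpace.exp (projMatrix V * H * projMatrix V) * projMatrix V

/-- On the whole space `expOn` is the ordinary matrix exponential. -/
theorem expOn_top (H : Matrix n n ℂ) : expOn ⊤ H = NormedSpace.exp H := by
  have h : projMatrix (⊤ : Submodule ℂ (EuclideanSpace ℂ n)) = 1 := by
    simp only [projMatrix, Submodule.starProjection_top']
    exact map_one _
  simp [expOn, h]

/-- The von Neumann entropy `-Tr (ρ log ρ)`. -/
def entropy (ρ : Matrix n n ℂ) : ℝ := -(ρ * mlog ρ).trace.re

open Classical in
/-- The relative entropy `S(ρ‖σ)` of positive semidefinite matrices, with value `+∞` unless the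
support of `ρ` is contained in that of `σ`. -/
def relEntropy (ρ σ : Matrix n n ℂ) : EReal :=
  if supp ρ ≤ supp σ then (((ρ * (mlog ρ - mlog σ)).trace.re : ℝ) : EReal) else ⊤

/-- The marginal on `AC` of an operator on `ABC` (partial trace over `B`). -/
def margAC (X : Matrix (a × b × c) (a × b × c) ℂ) : Matrix (a × c) (a × c) ℂ :=
  Matrix.of fun p q => ∑ j, X (p.1, j, p.2) (q.1, j, q.2)

/-- The marginal on `BC` of an operator on `ABC` (partial trace over `A`). -/
def margBC (X : Matrix (a × b × c) (a × b × c) ℂ) : Matrix (b × c) (b × c) ℂ :=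
  Matrix.of fun p q => ∑ i, X (i, p) (i, q)

/-- The marginal on `C` of an operator on `ABC` (partial trace over `A` and `B`). -/
def margC (X : Matrix (a × b × c) (a × b × c) ℂ) : Matrix c c ℂ :=
  Matrix.of fun p q => ∑ i, ∑ j, X (i, j, p) (i, j, q)

/-- An operator on `AC` regarded as an operator on `ABC`, acting as the identity on `B`. -/
def extAC (b : Type*) [DecidableEq b] (X : Matrix (a × c) (a × c) ℂ) :
    Matrix (a × b × c) (a × b × c) ℂ :=
  Matrix.of fun p q => if p.2.1 = q.2.1 then X (p.1, p.2.2) (q.1, q.2.2) else 0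

/-- An operator on `BC` regarded as an operator on `ABC`, acting as the identity on `A`. -/
def extBC (a : Type*) [DecidableEq a] (X : Matrix (b × c) (b × c) ℂ) :
    Matrix (a × b × c) (a × b × c) ℂ :=
  (1 : Matrix a a ℂ) ⊗ₖ X

/-- An operator on `C` regarded as an operator on `ABC`, acting as the identity on `A` and `B`. -/
def extC (a b : Type*) [DecidableEq a] [DecidableEq b] (X : Matrix c c ℂ) :
    Matrix (a × b × c) (a × b × c) ℂ :=
  (1 : Matrix a a ℂ) ⊗ₖ ((1 : Matrix b b ℂ) ⊗ₖ X)

/-- The conditional mutual information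
`I(A:B|C)_ρ = S(ρ_AC) + S(ρ_BC) - S(ρ_ABC) - S(ρ_C)`. -/
def condMutualInfo (ρ : Matrix (a × b × c) (a × b × c) ℂ) : ℝ :=
  entropy (margAC ρ) + entropy (margBC ρ) - entropy ρ - entropy (margC ρ)

/-- The operator `exp (log σ_AC + log σ_BC - log σ_C)` on `ABC`. If `σ_AC` and `σ_BC` are
invertible, the subspace below is the whole space and this is the ordinary exponential. In general
it is taken on the intersection of the supports of `σ_AC` and `σ_BC` (tensored with the identity)
and is zero on the orthogonal complement, where the exponent is `-∞`; this is the limit, as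
`ε → 0+`, of the operators obtained by adding `ε` times the identity to each marginal. -/
def expLogComb (σ : Matrix (a × b × c) (a × b × c) ℂ) : Matrix (a × b × c) (a × b × c) ℂ :=
  expOn (supp (extAC b (margAC σ)) ⊓ supp (extBC a (margBC σ)))
    (extAC b (mlog (margAC σ)) + extBC a (mlog (margBC σ)) - extC a b (mlog (margC σ)))

/-- A square matrix with a left inverse has full support. -/
theorem supp_eq_top {X Y : Matrix n n ℂ} (h : Y * X = 1) : supp X = ⊤ := by
  rw [supp, Submodule.orthogonal_eq_top_iff, LinearMap.ker_eq_bot']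
  intro v hv
  have h1 : X *ᵥ v.ofLp = 0 := by
    simpa using congrArg WithLp.ofLp hv
  have h2 : v.ofLp = 0 := by
    calc v.ofLp = (Y * X) *ᵥ v.ofLp := by rw [h, Matrix.one_mulVec]
      _ = 0 := by rw [← Matrix.mulVec_mulVec, h1, Matrix.mulVec_zero]
  ext i
  simpa using congrFun h2 i

/-- If the marginals on `AC` and `BC` are invertible, `expLogComb` is the ordinary exponential. -/
theorem expLogComb_of_isUnit (σ : Matrix (a × b × c) (a × b × c) ℂ)
    (h1 : IsUnit (margAC σ).det) (h2 : IsUnit (margBC σ).det) :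
    expLogComb σ = NormedSpace.exp
      (extAC b (mlog (margAC σ)) + extBC a (mlog (margBC σ)) - extC a b (mlog (margC σ))) := by
  have e1 : supp (extAC b (margAC σ)) = ⊤ := by
    refine supp_eq_top (Y := extAC b (margAC σ)⁻¹) ?_
    have h := Matrix.nonsing_inv_mul _ h1
    ext ⟨i, j, k⟩ ⟨i', j', k'⟩
    have h' := congrFun (congrFun h (i, k)) (i', k')
    simp only [Matrix.mul_apply, Fintype.sum_prod_type, Matrix.one_apply, Prod.mk.injEq] at h'
    simp only [Matrix.mul_apply, extAC, Matrix.of_apply, Fintype.sum_prod_type, Matrix.one_apply,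
      Prod.mk.injEq]
    by_cases hj : j = j'
    · subst hj
      simp only [true_and, ← h']
      refine Finset.sum_congr rfl fun x _ => ?_
      rw [Finset.sum_eq_single j (by intro y _ hy; simp [hy]) (by simp)]
      simp
    · simp only [hj, false_and, and_false, if_false]
      refine Finset.sum_eq_zero fun x _ => Finset.sum_eq_zero fun y _ =>
        Finset.sum_eq_zero fun z _ => ?_
      by_cases hy : j = y
      · subst hy; simp [hj]
      · simp [hy]
  have e2 : supp (extBC a (margBC σ)) = ⊤ := by
    refine supp_eq_top (Y := extBC a (margBC σ)⁻¹) ?_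
    rw [extBC, extBC, ← Matrix.mul_kronecker_mul, Matrix.nonsing_inv_mul _ h2]
    simp
  rw [expLogComb, e1, e2, inf_top_eq, expOn_top]

end QEntropy

end

/-!
Let `ρ` be supported in the subspace on which `expLogComb σ` lives; otherwise the left-hand side is
`+∞`. There `log (expLogComb σ)` is the compression of `log σ_AC + log σ_BC - log σ_C`
(`mlog_expOn`), so `Tr ρ log (expLogComb σ)` splits into marginal terms
(`trace_mul_mlog_expLogComb`), and
`S(ρ‖expLogComb σ) = I(A:B|C)_ρ + S(ρ_AC‖σ_AC) + S(ρ_BC‖σ_BC) - S(ρ_C‖σ_C)`.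
The claim is therefore half the sum of the inequalities `S(ρ_AC‖σ_AC) ≥ S(ρ_C‖σ_C)` and
`S(ρ_BC‖σ_BC) ≥ S(ρ_C‖σ_C)`, two instances of the monotonicity of the relative entropy under
partial trace (`IsTraceDual.trace_mul_mlog_sub_le`).

Monotonicity is proved as follows. With `L` and `R` the left and right multiplications, put
`D(T) = Tr (ρ * log (T R_ρ + L_σ) 1)`, a double sum over the eigenvalues of `ρ` and `σ`
(`logSum`). Then `D(0) = Tr ρ log σ`, and `D(T) - (log T) Tr ρ` tends to `Tr ρ log ρ` as `T → ∞`, so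
the relative entropy is the growth of `D` along `[0, ∞)`, with `(log T) Tr ρ` removed. The
derivative of `D` at `t` is
`Tr (ρ * (t R_ρ + L_σ)⁻¹ ρ) = max_X (2 Re Tr ρ X - t Tr ρ Xᴴ X - Tr σ X Xᴴ)`
(`resolventForm_le_resolventSum`, `exists_resolventForm_eq_resolventSum`). The functional on the
right is linear in `(ρ, σ)`, so on operators `X = ι Y` coming from a tensor factor it equals the
functional of the reduced operators. Taking the reduced states can only decrease the maximum, hence
the derivative of `D`, hence the relative entropy.
-/

namespace QEntropy

/-! ### Spectral decompositions and functional calculus -/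

section Spectral

variable {n : Type*} [Fintype n] [DecidableEq n]

theorem cfc_eq_mul_diagonal_mul {A : Matrix n n ℂ} (hA : A.IsHermitian) (f : ℝ → ℝ) :
    cfc f A = (hA.eigenvectorUnitary : Matrix n n ℂ) *
      Matrix.diagonal (fun i => (f (hA.eigenvalues i) : ℂ)) *
        (hA.eigenvectorUnitary : Matrix n n ℂ)ᴴ := by
  rw [hA.cfc_eq, Matrix.IsHermitian.cfc, Unitary.conjStarAlgAut_apply]
  rfl

theorem eq_mul_diagonal_mul {A : Matrix n n ℂ} (hA : A.IsHermitian) :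
    A = (hA.eigenvectorUnitary : Matrix n n ℂ) *
      Matrix.diagonal (fun i => (hA.eigenvalues i : ℂ)) *
        (hA.eigenvectorUnitary : Matrix n n ℂ)ᴴ := by
  conv_lhs => rw [← cfc_id ℝ A hA]
  exact cfc_eq_mul_diagonal_mul hA id

theorem conjTranspose_mul_eigenvectorUnitary {A : Matrix n n ℂ} (hA : A.IsHermitian) :
    (hA.eigenvectorUnitary : Matrix n n ℂ)ᴴ * (hA.eigenvectorUnitary : Matrix n n ℂ) = 1 :=
  Unitary.coe_star_mul_self _

theorem eigenvectorUnitary_mul_conjTranspose {A : Matrix n n ℂ} (hA : A.IsHermitian) :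
    (hA.eigenvectorUnitary : Matrix n n ℂ) * (hA.eigenvectorUnitary : Matrix n n ℂ)ᴴ = 1 :=
  Unitary.coe_mul_star_self _

/-- The matrix of inner products `⟨f_j, e_i⟩` of the eigenbasis `f` of `B` with the
eigenbasis `e` of `A`. -/
noncomputable def overlap {A B : Matrix n n ℂ} (hA : A.IsHermitian) (hB : B.IsHermitian) :
    Matrix n n ℂ :=
  (hB.eigenvectorUnitary : Matrix n n ℂ)ᴴ * (hA.eigenvectorUnitary : Matrix n n ℂ)

theorem conjTranspose_overlap {A B : Matrix n n ℂ} (hA : A.IsHermitian) (hB : B.IsHermitian) :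
    (overlap hA hB)ᴴ =
      (hA.eigenvectorUnitary : Matrix n n ℂ)ᴴ * (hB.eigenvectorUnitary : Matrix n n ℂ) := by
  simp [overlap, Matrix.conjTranspose_mul]

theorem trace_diagonal_conjTranspose_mul (d : n → ℂ) (M N : Matrix n n ℂ) :
    (Matrix.diagonal d * (Mᴴ * N)).trace = ∑ i, ∑ j, d i * (star (M j i) * N j i) := by
  simp only [Matrix.trace, Matrix.diag_apply, Matrix.diagonal_mul]
  simp [Matrix.mul_apply, Finset.mul_sum]

theorem trace_diagonal_mul_conjTranspose (d : n → ℂ) (N : Matrix n n ℂ) :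
    (Matrix.diagonal d * (N * Nᴴ)).trace = ∑ i, ∑ j, d j * (star (N j i) * N j i) := by
  rw [Finset.sum_comm]
  simp only [Matrix.trace, Matrix.diag_apply, Matrix.diagonal_mul]
  simp [Matrix.mul_apply, Finset.mul_sum, mul_comm]

theorem trace_cfc_mul_cfc {A B : Matrix n n ℂ} (hA : A.IsHermitian) (hB : B.IsHermitian)
    (f g : ℝ → ℝ) :
    (cfc f A * cfc g B).trace.re = ∑ i, ∑ j, ‖overlap hA hB j i‖ ^ 2 *
      (f (hA.eigenvalues i) * g (hB.eigenvalues j)) := by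
  have h : (cfc f A * cfc g B).trace =
      (Matrix.diagonal (fun i => (f (hA.eigenvalues i) : ℂ)) * ((overlap hA hB)ᴴ *
        (Matrix.diagonal (fun i => (g (hB.eigenvalues i) : ℂ)) * overlap hA hB))).trace := by
    rw [conjTranspose_overlap, overlap, cfc_eq_mul_diagonal_mul hA, cfc_eq_mul_diagonal_mul hB]
    conv_lhs => rw [Matrix.mul_assoc, Matrix.mul_assoc, Matrix.trace_mul_comm]
    simp only [Matrix.mul_assoc]
  rw [h, trace_diagonal_conjTranspose_mul, Complex.re_sum]
  refine Finset.sum_congr rfl fun i _ => ?_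
  rw [Complex.re_sum]
  refine Finset.sum_congr rfl fun j _ => ?_
  rw [Matrix.diagonal_mul, ← Complex.ofReal_re (‖overlap hA hB j i‖ ^ 2 * _)]
  congr 1
  push_cast
  rw [← Complex.conj_mul']
  simp only [Complex.star_def]
  ring

/-- A functional calculus acts on eigenvectors through their eigenvalue. -/
theorem cfc_mulVec_of_mulVec_eq_smul {A : Matrix n n ℂ} (hA : A.IsHermitian) (f : ℝ → ℝ)
    {v : n → ℂ} {x : ℝ} (hv : A *ᵥ v = (x : ℂ) • v) : cfc f A *ᵥ v = (f x : ℂ) • v := by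
  set U := (hA.eigenvectorUnitary : Matrix n n ℂ) with hU
  have hUU : Uᴴ * U = 1 := conjTranspose_mul_eigenvectorUnitary hA
  have hUU' : U * Uᴴ = 1 := eigenvectorUnitary_mul_conjTranspose hA
  have key : ∀ i, (hA.eigenvalues i : ℂ) * (Uᴴ *ᵥ v) i = x * (Uᴴ *ᵥ v) i := by
    intro i
    have h1 : Uᴴ *ᵥ (A *ᵥ v) =
        Matrix.diagonal (fun i => (hA.eigenvalues i : ℂ)) *ᵥ (Uᴴ *ᵥ v) := by
      conv_lhs => rw [eq_mul_diagonal_mul hA]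
      simp only [Matrix.mulVec_mulVec, ← hU, ← Matrix.mul_assoc, hUU, Matrix.one_mul]
    have h2 := congrFun h1 i
    rw [hv, Matrix.mulVec_smul, Matrix.mulVec_diagonal] at h2
    simpa using h2.symm
  have h3 : Matrix.diagonal (fun i => (f (hA.eigenvalues i) : ℂ)) *ᵥ (Uᴴ *ᵥ v) =
      (f x : ℂ) • (Uᴴ *ᵥ v) := by
    ext i
    rw [Matrix.mulVec_diagonal, Pi.smul_apply, smul_eq_mul]
    by_cases h0 : (Uᴴ *ᵥ v) i = 0
    · simp [h0]
    · rw [Complex.ofReal_injective (mul_right_cancel₀ h0 (key i))]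
  rw [cfc_eq_mul_diagonal_mul hA, ← hU, ← Matrix.mulVec_mulVec, ← Matrix.mulVec_mulVec, h3,
    Matrix.mulVec_smul, Matrix.mulVec_mulVec, hUU', Matrix.one_mulVec]

/-- Since the eigenvectors of `A` span, a functional calculus of `A` is determined by its
values on them. -/
theorem cfc_eq_of_forall_mulVec {A K : Matrix n n ℂ} (hA : A.IsHermitian) (f : ℝ → ℝ)
    (h : ∀ (v : n → ℂ) (x : ℝ), A *ᵥ v = (x : ℂ) • v → K *ᵥ v = (f x : ℂ) • v) :
    cfc f A = K := by
  set U := (hA.eigenvectorUnitary : Matrix n n ℂ) with hU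
  have hUU' : U * Uᴴ = 1 := eigenvectorUnitary_mul_conjTranspose hA
  have hcol : (cfc f A) * U = K * U := by
    ext i j
    have hj : A *ᵥ (fun k => U k j) = ((hA.eigenvalues j : ℝ) : ℂ) • fun k => U k j := by
      have := hA.mulVec_eigenvectorBasis j
      exact this
    have := (cfc_mulVec_of_mulVec_eq_smul hA f hj).trans (h _ _ hj).symm
    exact congrFun this i
  calc cfc f A = cfc f A * U * Uᴴ := by rw [Matrix.mul_assoc, hUU', Matrix.mul_one]
    _ = K := by rw [hcol, Matrix.mul_assoc, hUU', Matrix.mul_one]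

end Spectral

/-! ### The variational form of the derivative -/

section Resolvent

variable {n : Type*} [Fintype n] [DecidableEq n]

/-- The quadratic functional of `X` whose maximum is
`Tr (ρ * (t R_ρ + L_σ)⁻¹ ρ)`, with `L` and `R` the left and right multiplications. It is linear in
the pair `(ρ, σ)`. -/
def resolventForm (t : ℝ) (ρ σ X : Matrix n n ℂ) : ℝ :=
  2 * (ρ * X).trace.re - t * (ρ * (Xᴴ * X)).trace.re - (σ * (X * Xᴴ)).trace.re

/-- The quantity `Tr (ρ * (t R_ρ + L_σ)⁻¹ ρ)` computed in the eigenbases of `ρ` and `σ`; a term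
with vanishing denominator is zero. -/
noncomputable def resolventSum (t : ℝ) {ρ σ : Matrix n n ℂ} (hρ : ρ.IsHermitian)
    (hσ : σ.IsHermitian) : ℝ :=
  ∑ i, ∑ j, ‖overlap hρ hσ j i‖ ^ 2 *
    (hρ.eigenvalues i ^ 2 / (t * hρ.eigenvalues i + hσ.eigenvalues j))

/-- In the eigenbases of `ρ` and `σ`, `resolventForm` decouples into scalar quadratics. -/
theorem resolventForm_mul_mul (t : ℝ) {ρ σ : Matrix n n ℂ} (hρ : ρ.IsHermitian)
    (hσ : σ.IsHermitian) (Y : Matrix n n ℂ) :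
    resolventForm t ρ σ ((hσ.eigenvectorUnitary : Matrix n n ℂ) * Y *
        (hρ.eigenvectorUnitary : Matrix n n ℂ)ᴴ) =
      ∑ i, ∑ j, (2 * hρ.eigenvalues i * (star (overlap hρ hσ j i) * Y j i).re -
        (t * hρ.eigenvalues i + hσ.eigenvalues j) * ‖Y j i‖ ^ 2) := by
  set U := (hρ.eigenvectorUnitary : Matrix n n ℂ) with hU
  set V := (hσ.eigenvectorUnitary : Matrix n n ℂ) with hV
  set P := Matrix.diagonal (fun i => (hρ.eigenvalues i : ℂ)) with hP
  set Q := Matrix.diagonal (fun i => (hσ.eigenvalues i : ℂ)) with hQ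
  have hUU : Uᴴ * U = 1 := conjTranspose_mul_eigenvectorUnitary hρ
  have hVV : Vᴴ * V = 1 := conjTranspose_mul_eigenvectorUnitary hσ
  have eρ : ρ = U * P * Uᴴ := eq_mul_diagonal_mul hρ
  have eσ : σ = V * Q * Vᴴ := eq_mul_diagonal_mul hσ
  have cU : ∀ Z : Matrix n n ℂ, Uᴴ * (U * Z) = Z := fun Z => by
    rw [← Matrix.mul_assoc, hUU, Matrix.one_mul]
  have cV : ∀ Z : Matrix n n ℂ, Vᴴ * (V * Z) = Z := fun Z => by
    rw [← Matrix.mul_assoc, hVV, Matrix.one_mul]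
  have h1 : (ρ * (V * Y * Uᴴ)).trace = (P * ((overlap hρ hσ)ᴴ * Y)).trace := by
    rw [conjTranspose_overlap, ← hU, ← hV, eρ]
    simp only [Matrix.mul_assoc]
    rw [Matrix.trace_mul_comm]
    simp only [Matrix.mul_assoc, hUU, Matrix.mul_one]
  have h2 : (ρ * ((V * Y * Uᴴ)ᴴ * (V * Y * Uᴴ))).trace = (P * (Yᴴ * Y)).trace := by
    rw [eρ]
    simp only [Matrix.conjTranspose_mul, Matrix.conjTranspose_conjTranspose, Matrix.mul_assoc, cU,
      cV]
    rw [Matrix.trace_mul_comm]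
    simp only [Matrix.mul_assoc, hUU, Matrix.mul_one]
  have h3 : (σ * ((V * Y * Uᴴ) * (V * Y * Uᴴ)ᴴ)).trace = (Q * (Y * Yᴴ)).trace := by
    rw [eσ]
    simp only [Matrix.conjTranspose_mul, Matrix.conjTranspose_conjTranspose, Matrix.mul_assoc, cU,
      cV]
    rw [Matrix.trace_mul_comm]
    simp only [Matrix.mul_assoc, hVV, Matrix.mul_one]
  rw [resolventForm, h1, h2, h3, trace_diagonal_conjTranspose_mul,
    trace_diagonal_conjTranspose_mul, trace_diagonal_mul_conjTranspose]
  simp only [Complex.re_sum, Finset.mul_sum, ← Finset.sum_sub_distrib]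
  refine Finset.sum_congr rfl fun i _ => Finset.sum_congr rfl fun j _ => ?_
  have hn : star (Y j i) * Y j i = ((‖Y j i‖ ^ 2 : ℝ) : ℂ) := by
    rw [Complex.star_def, Complex.conj_mul']
    push_cast
    rfl
  rw [hn]
  simp only [Complex.re_ofReal_mul, Complex.ofReal_re]
  ring

/-- Completing the square; the constraint `d = 0 → p = 0` covers the degenerate quadratic. -/
theorem two_mul_re_sub_le (p d : ℝ) (hd : 0 ≤ d) (h : d = 0 → p = 0) (u y : ℂ) :
    2 * p * (star u * y).re - d * ‖y‖ ^ 2 ≤ ‖u‖ ^ 2 * (p ^ 2 / d) := by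
  rcases hd.eq_or_lt with h0 | h0
  · simp [← h0, h h0.symm]
  · have h1 : |(star u * y).re| ≤ ‖u‖ * ‖y‖ := by
      simpa using Complex.abs_re_le_norm (star u * y)
    have h2 : p * (star u * y).re ≤ |p| * (‖u‖ * ‖y‖) :=
      (le_abs_self _).trans (by rw [abs_mul]; gcongr)
    rw [← mul_div_assoc, le_div_iff₀ h0]
    nlinarith [sq_nonneg (|p| * ‖u‖ - d * ‖y‖), sq_abs p]

/-- The equality case of `two_mul_re_sub_le`. -/
theorem two_mul_re_sub_eq (p d : ℝ) (u : ℂ) :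
    2 * p * (star u * (((p / d : ℝ) : ℂ) * u)).re - d * ‖((p / d : ℝ) : ℂ) * u‖ ^ 2 =
      ‖u‖ ^ 2 * (p ^ 2 / d) := by
  have h1 : (star u * (((p / d : ℝ) : ℂ) * u)).re = p / d * ‖u‖ ^ 2 := by
    rw [mul_left_comm, Complex.star_def, Complex.conj_mul', Complex.re_ofReal_mul,
      ← Complex.ofReal_pow, Complex.ofReal_re]
  rw [h1, norm_mul, Complex.norm_real, mul_pow, Real.norm_eq_abs, sq_abs]
  rcases eq_or_ne d 0 with h0 | h0
  · simp [h0]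
  · field_simp
    ring

/-- `resolventSum` bounds `resolventForm` from above; equality is attained by
`exists_resolventForm_eq_resolventSum`. -/
theorem resolventForm_le_resolventSum {t : ℝ} (ht : 0 < t) {ρ σ : Matrix n n ℂ}
    (hρ : ρ.PosSemidef) (hσ : σ.PosSemidef) (X : Matrix n n ℂ) :
    resolventForm t ρ σ X ≤ resolventSum t hρ.isHermitian hσ.isHermitian := by
  set U := (hρ.isHermitian.eigenvectorUnitary : Matrix n n ℂ) with hU
  set V := (hσ.isHermitian.eigenvectorUnitary : Matrix n n ℂ) with hV
  have hX : X = V * (Vᴴ * X * U) * Uᴴ := by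
    rw [← Matrix.mul_assoc, ← Matrix.mul_assoc, eigenvectorUnitary_mul_conjTranspose,
      Matrix.one_mul, Matrix.mul_assoc, eigenvectorUnitary_mul_conjTranspose, Matrix.mul_one]
  rw [hX, resolventForm_mul_mul, resolventSum]
  refine Finset.sum_le_sum fun i _ => Finset.sum_le_sum fun j _ => ?_
  have hp := hρ.eigenvalues_nonneg i
  have hq := hσ.eigenvalues_nonneg j
  refine two_mul_re_sub_le _ _ (by positivity) (fun h0 => ?_) _ _
  nlinarith [mul_nonneg ht.le hp, mul_pos ht ht]

theorem exists_resolventForm_eq_resolventSum (t : ℝ) {ρ σ : Matrix n n ℂ}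
    (hρ : ρ.PosSemidef) (hσ : σ.PosSemidef) :
    ∃ X, resolventForm t ρ σ X = resolventSum t hρ.isHermitian hσ.isHermitian := by
  -- in the eigenbases, take the vertex of each scalar quadratic
  refine ⟨_, (resolventForm_mul_mul t hρ.isHermitian hσ.isHermitian
    (Matrix.of fun j i => ((hρ.isHermitian.eigenvalues i /
      (t * hρ.isHermitian.eigenvalues i + hσ.isHermitian.eigenvalues j) : ℝ) : ℂ) *
        overlap hρ.isHermitian hσ.isHermitian j i)).trans ?_⟩
  exact Finset.sum_congr rfl fun i _ => Finset.sum_congr rfl fun j _ =>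
    two_mul_re_sub_eq _ _ _

end Resolvent

/-! ### Supports and the logarithm of `expOn` -/

section Support

variable {n : Type*} [Fintype n] [DecidableEq n]

theorem supp_le_iff_orthogonal_le_ker (X : Matrix n n ℂ)
    (V : Submodule ℂ (EuclideanSpace ℂ n)) :
    supp X ≤ V ↔ Vᗮ ≤ LinearMap.ker (Matrix.toEuclideanLin X) := by
  rw [supp]
  constructor
  · intro h
    have := Submodule.orthogonal_le h
    rwa [Submodule.orthogonal_orthogonal] at this
  · intro h
    have := Submodule.orthogonal_le h
    rwa [Submodule.orthogonal_orthogonal] at this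

theorem supp_le_iff_forall_mulVec {X Y : Matrix n n ℂ} :
    supp X ≤ supp Y ↔ ∀ v : n → ℂ, Y *ᵥ v = 0 → X *ᵥ v = 0 := by
  rw [supp_le_iff_orthogonal_le_ker, supp, Submodule.orthogonal_orthogonal]
  constructor
  · intro h v hv
    have := h (x := WithLp.toLp 2 v) (by simp [LinearMap.mem_ker, hv])
    simpa [LinearMap.mem_ker] using this
  · intro h v hv
    have := h v.ofLp (by simpa [LinearMap.mem_ker] using congrArg WithLp.ofLp hv)
    rw [LinearMap.mem_ker]
    ext i
    simpa using congrFun this i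

theorem supp_le_iff_forall_mul {X Y : Matrix n n ℂ} :
    supp X ≤ supp Y ↔ ∀ Z : Matrix n n ℂ, Y * Z = 0 → X * Z = 0 := by
  rw [supp_le_iff_forall_mulVec]
  constructor
  · intro h Z hZ
    ext i j
    have h1 : Y *ᵥ (fun k => Z k j) = 0 := by
      ext l
      exact congrFun (congrFun hZ l) j
    exact congrFun (h _ h1) i
  · intro h v hv
    have h1 : Y * Matrix.of (fun k (_ : n) => v k) = 0 := by
      ext l _
      exact congrFun hv l
    ext i
    exact congrFun (congrFun (h _ h1) i) i

theorem isHermitian_projMatrix (V : Submodule ℂ (EuclideanSpace ℂ n)) :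
    (projMatrix V)ᴴ = projMatrix V := by
  have h := (Matrix.toEuclideanCLM (n := n) (𝕜 := ℂ)).symm.map_star' V.starProjection
  rw [(isSelfAdjoint_starProjection V).star_eq] at h
  exact h.symm

theorem projMatrix_mul_self (V : Submodule ℂ (EuclideanSpace ℂ n)) :
    projMatrix V * projMatrix V = projMatrix V := by
  rw [projMatrix, ← map_mul]
  congr 1
  exact (Submodule.isIdempotentElem_starProjection V)

theorem projMatrix_mulVec (V : Submodule ℂ (EuclideanSpace ℂ n)) (v : EuclideanSpace ℂ n) :
    projMatrix V *ᵥ v.ofLp = (V.starProjection v).ofLp := by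
  have := Matrix.ofLp_toEuclideanCLM (𝕜 := ℂ) (projMatrix V) v
  rw [← this, projMatrix, StarAlgEquiv.apply_symm_apply]

theorem supp_le_iff_mul_projMatrix (X : Matrix n n ℂ)
    (V : Submodule ℂ (EuclideanSpace ℂ n)) : supp X ≤ V ↔ X * projMatrix V = X := by
  rw [supp_le_iff_orthogonal_le_ker]
  constructor
  · intro h
    refine Matrix.ext_of_mulVec_single fun i => ?_
    have h1 := h (V.sub_starProjection_mem_orthogonal (WithLp.toLp 2 (Pi.single i 1)))
    rw [LinearMap.mem_ker, map_sub, sub_eq_zero] at h1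
    rw [← Matrix.mulVec_mulVec]
    have h2 := projMatrix_mulVec V (WithLp.toLp 2 (Pi.single i 1))
    rw [WithLp.ofLp_toLp] at h2
    rw [h2]
    simpa using (congrArg WithLp.ofLp h1).symm
  · intro h v hv
    rw [LinearMap.mem_ker, ← h]
    have h2 := projMatrix_mulVec V v
    rw [(Submodule.starProjection_apply_eq_zero_iff V).2 hv] at h2
    ext i
    rw [Matrix.toLpLin_apply, ← Matrix.mulVec_mulVec, h2]
    simp

/-- The support of `expOn V H` lies in `V`. -/
theorem supp_expOn_le (V : Submodule ℂ (EuclideanSpace ℂ n)) (H : Matrix n n ℂ) :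
    supp (expOn V H) ≤ V := by
  rw [supp_le_iff_mul_projMatrix, expOn, Matrix.mul_assoc, projMatrix_mul_self]

open scoped Matrix.Norms.L2Operator in
theorem mlog_exp {K : Matrix n n ℂ} (hK : K.IsHermitian) : mlog (NormedSpace.exp K) = K :=
  CFC.log_exp K hK

/-- The logarithm of `expOn V H` is the compression of `H` to `V`: an eigenvector of `expOn V H`
is either in `V`, and an eigenvector of the exponential, or orthogonal to `V`. -/
theorem mlog_expOn (V : Submodule ℂ (EuclideanSpace ℂ n)) {H : Matrix n n ℂ}
    (hH : H.IsHermitian) : mlog (expOn V H) = projMatrix V * H * projMatrix V := by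
  set P := projMatrix V with hP
  set K := P * H * P with hK
  have hPP : P * P = P := projMatrix_mul_self V
  have hPs : Pᴴ = P := isHermitian_projMatrix V
  have hKs : K.IsHermitian := by
    rw [Matrix.IsHermitian, hK]
    simp only [Matrix.conjTranspose_mul, hPs, hH.eq, Matrix.mul_assoc]
  have hKP : K * P = K := by rw [hK, Matrix.mul_assoc, hPP]
  have hPK : P * K = K := by rw [hK, ← Matrix.mul_assoc, ← Matrix.mul_assoc, hPP]
  have hcomm : P * NormedSpace.exp K = NormedSpace.exp K * P :=
    (Commute.exp_right (show Commute P K by rw [commute_iff_eq, hKP, hPK])).eq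
  have hE : expOn V H = NormedSpace.exp K * P := by
    rw [expOn, ← hP, ← hK, hcomm, Matrix.mul_assoc, hPP]
  have hEs : (NormedSpace.exp K).IsHermitian := hKs.exp
  have hM : (expOn V H).IsHermitian := by
    rw [Matrix.IsHermitian, hE, Matrix.conjTranspose_mul, hPs, hEs.eq, hcomm]
  refine cfc_eq_of_forall_mulVec hM Real.log fun v x hv => ?_
  have hPM : P * expOn V H = expOn V H := by rw [hE, ← Matrix.mul_assoc, hcomm, Matrix.mul_assoc,
    hPP]
  by_cases hx : x = 0
  · -- the exponential is invertible, so `v` is orthogonal to `V`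
    have h1 : P *ᵥ v = 0 := by
      have h2 : NormedSpace.exp (-K) *ᵥ (expOn V H *ᵥ v) = P *ᵥ v := by
        rw [hE, Matrix.mulVec_mulVec, ← Matrix.mul_assoc, Matrix.exp_neg,
          Matrix.nonsing_inv_mul _ ((Matrix.isUnit_iff_isUnit_det _).1 (Matrix.isUnit_exp K)),
          Matrix.one_mul]
      rw [← h2, hv, hx]
      simp
    rw [← hKP, ← Matrix.mulVec_mulVec, h1, hx]
    simp
  · have hx' : (x : ℂ) ≠ 0 := by exact_mod_cast hx
    have h1 : P *ᵥ v = v := by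
      have h2 : P *ᵥ (expOn V H *ᵥ v) = expOn V H *ᵥ v := by rw [Matrix.mulVec_mulVec, hPM]
      rw [hv, Matrix.mulVec_smul] at h2
      exact smul_right_injective _ hx' h2
    have h3 : NormedSpace.exp K *ᵥ v = (x : ℂ) • v := by
      rw [← hv, hE, ← Matrix.mulVec_mulVec, h1]
    have h4 := cfc_mulVec_of_mulVec_eq_smul hEs Real.log h3
    have h5 : cfc Real.log (NormedSpace.exp K) = K := mlog_exp hKs
    rwa [h5] at h4

end Support

/-! ### Monotonicity of the relative entropy -/

section DataProcessing

open Filter Topology Set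

variable {m n : Type*} [Fintype m] [DecidableEq m] [Fintype n] [DecidableEq n]

open scoped MatrixOrder Matrix.Norms.L2Operator in
theorem posSemidef_mul_eq_zero_iff_trace {Y : Matrix n n ℂ} (hY : Y.PosSemidef)
    (W : Matrix n n ℂ) : Y * W = 0 ↔ (Y * (W * Wᴴ)).trace = 0 := by
  constructor
  · intro h
    rw [← Matrix.mul_assoc, h, Matrix.zero_mul, Matrix.trace_zero]
  · intro h
    obtain ⟨B, hB⟩ := CStarAlgebra.nonneg_iff_eq_star_mul_self.1 hY.nonneg
    have h2 : ((B * W)ᴴ * (B * W)).trace = 0 := by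
      rw [← h, hB, Matrix.star_eq_conjTranspose, Matrix.conjTranspose_mul, Matrix.mul_assoc,
        Matrix.trace_mul_comm]
      simp only [Matrix.mul_assoc]
    rw [hB, Matrix.mul_assoc, Matrix.trace_conjTranspose_mul_self_eq_zero_iff.1 h2,
      Matrix.mul_zero]

/-- `E` is the adjoint of the unital `*`-homomorphism `ι` for the trace pairing. For an embedding
of a tensor factor, `E` is the partial trace over the other factor. -/
def IsTraceDual (ι : Matrix m m ℂ →⋆ₐ[ℂ] Matrix n n ℂ) (E : Matrix n n ℂ → Matrix m m ℂ) : Prop :=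
  ∀ (Y : Matrix n n ℂ) (X : Matrix m m ℂ), (Y * ι X).trace = (E Y * X).trace

namespace IsTraceDual

variable {ι : Matrix m m ℂ →⋆ₐ[ℂ] Matrix n n ℂ} {E : Matrix n n ℂ → Matrix m m ℂ}

theorem trace_eq (h : IsTraceDual ι E) (Y : Matrix n n ℂ) : (E Y).trace = Y.trace := by
  simpa using (h Y 1).symm

open scoped MatrixOrder Matrix.Norms.L2Operator in
theorem posSemidef (h : IsTraceDual ι E) {Y : Matrix n n ℂ} (hY : Y.PosSemidef) :
    (E Y).PosSemidef := by
  have hH : (E Y).IsHermitian := by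
    refine Matrix.ext_iff_trace_mul_right.2 fun X => ?_
    have h1 : ((E Y)ᴴ * X).trace = star ((E Y * Xᴴ).trace) := by
      rw [← Matrix.trace_conjTranspose, Matrix.conjTranspose_mul,
        Matrix.conjTranspose_conjTranspose, Matrix.trace_mul_comm]
    rw [h1, ← h, ← h, ← Matrix.trace_conjTranspose, Matrix.conjTranspose_mul,
      ← Matrix.star_eq_conjTranspose, ← Matrix.star_eq_conjTranspose X, map_star, star_star,
      hY.isHermitian.eq, Matrix.trace_mul_comm]
  refine Matrix.posSemidef_iff_dotProduct_mulVec.2 ⟨hH, fun v => ?_⟩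
  obtain ⟨B, hB⟩ := CStarAlgebra.nonneg_iff_eq_star_mul_self.1
    (Matrix.posSemidef_vecMulVec_self_star v).nonneg
  have h1 : star v ⬝ᵥ (E Y *ᵥ v) = (E Y * Matrix.vecMulVec v (star v)).trace := by
    rw [Matrix.mul_vecMulVec, Matrix.trace_vecMulVec, dotProduct_comm]
  have h2 : (E Y * Matrix.vecMulVec v (star v)).trace = (ι B * Y * (ι B)ᴴ).trace := by
    rw [hB, ← h, map_mul, map_star, Matrix.star_eq_conjTranspose, ← Matrix.mul_assoc,
      Matrix.trace_mul_comm, Matrix.mul_assoc]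
  rw [h1, h2]
  exact (hY.mul_mul_conjTranspose_same _).trace_nonneg

/-- Both sides say that a positive semidefinite operator has zero expectation in `Z Zᴴ`; the two
expectations agree by duality. -/
theorem mul_eq_zero_iff (h : IsTraceDual ι E) {Y : Matrix n n ℂ} (hY : Y.PosSemidef)
    (Z : Matrix m m ℂ) : E Y * Z = 0 ↔ Y * ι Z = 0 := by
  rw [posSemidef_mul_eq_zero_iff_trace hY, posSemidef_mul_eq_zero_iff_trace (h.posSemidef hY),
    ← h, map_mul, ← Matrix.star_eq_conjTranspose, map_star, Matrix.star_eq_conjTranspose]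

/-- If `ρ` is supported in the support of `ι τ`, then `E ρ` is supported in that of `τ`. -/
theorem supp_le_of_supp_le_map (h : IsTraceDual ι E) {ρ : Matrix n n ℂ} (hρ : ρ.PosSemidef)
    {τ : Matrix m m ℂ} (hs : supp ρ ≤ supp (ι τ)) : supp (E ρ) ≤ supp τ := by
  rw [supp_le_iff_forall_mul] at hs ⊢
  intro Z hZ
  exact (h.mul_eq_zero_iff hρ Z).2 (hs _ (by rw [← map_mul, hZ, map_zero]))

theorem supp_le_supp (h : IsTraceDual ι E) {ρ σ : Matrix n n ℂ} (hρ : ρ.PosSemidef)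
    (hσ : σ.PosSemidef) (hs : supp ρ ≤ supp σ) : supp (E ρ) ≤ supp (E σ) := by
  rw [supp_le_iff_forall_mul] at hs ⊢
  intro Z hZ
  exact (h.mul_eq_zero_iff hρ Z).2 (hs _ ((h.mul_eq_zero_iff hσ Z).1 hZ))

/-- The functional is linear in `ρ` and `σ`, and `ι` preserves products and adjoints of `X`. -/
theorem resolventForm_map (h : IsTraceDual ι E) (t : ℝ) (ρ σ : Matrix n n ℂ)
    (X : Matrix m m ℂ) : resolventForm t ρ σ (ι X) = resolventForm t (E ρ) (E σ) X := by
  simp only [resolventForm, ← Matrix.star_eq_conjTranspose, ← map_star, ← map_mul, h _ _]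

/-- The maximum over all `X` dominates the maximum over the range of `ι`. -/
theorem resolventSum_le (h : IsTraceDual ι E) {t : ℝ} (ht : 0 < t) {ρ σ : Matrix n n ℂ}
    (hρ : ρ.PosSemidef) (hσ : σ.PosSemidef) :
    resolventSum t (h.posSemidef hρ).isHermitian (h.posSemidef hσ).isHermitian ≤
      resolventSum t hρ.isHermitian hσ.isHermitian := by
  obtain ⟨X, hX⟩ := exists_resolventForm_eq_resolventSum t (h.posSemidef hρ) (h.posSemidef hσ)
  rw [← hX, ← h.resolventForm_map]
  exact resolventForm_le_resolventSum ht hρ hσ _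

end IsTraceDual

/-- The quantity `Tr (ρ * log (T R_ρ + L_σ) 1)`, with `L` and `R` the left and right
multiplications, computed in the eigenbases of `ρ` and `σ`. It interpolates between
`Tr ρ log σ` at `T = 0` and `Tr ρ log ρ + (log T) Tr ρ` for large `T`. -/
noncomputable def logSum {ρ σ : Matrix n n ℂ} (hρ : ρ.IsHermitian) (hσ : σ.IsHermitian)
    (T : ℝ) : ℝ :=
  ∑ i, ∑ j, ‖overlap hρ hσ j i‖ ^ 2 *
    (hρ.eigenvalues i * Real.log (T * hρ.eigenvalues i + hσ.eigenvalues j))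

theorem logSum_zero {ρ σ : Matrix n n ℂ} (hρ : ρ.IsHermitian) (hσ : σ.IsHermitian) :
    logSum hρ hσ 0 = (ρ * mlog σ).trace.re := by
  have h := trace_cfc_mul_cfc hρ hσ id Real.log
  rw [cfc_id ℝ ρ hρ.isSelfAdjoint] at h
  rw [mlog, h, logSum]
  simp

theorem tendsto_logSum_sub {ρ σ : Matrix n n ℂ} (hρ : ρ.PosSemidef) (hσ : σ.PosSemidef) :
    Tendsto (fun T => logSum hρ.isHermitian hσ.isHermitian T - Real.log T * ρ.trace.re) atTop
      (𝓝 (ρ * mlog ρ).trace.re) := by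
  have h1 : ρ.trace.re = ∑ i, ∑ j, ‖overlap hρ.isHermitian hσ.isHermitian j i‖ ^ 2 *
      hρ.isHermitian.eigenvalues i := by
    have h := trace_cfc_mul_cfc hρ.isHermitian hσ.isHermitian id (fun _ => 1)
    rw [cfc_id ℝ ρ hρ.isHermitian.isSelfAdjoint,
      cfc_const_one ℝ σ hσ.isHermitian.isSelfAdjoint, mul_one] at h
    simpa using h
  have h2 : (ρ * mlog ρ).trace.re = ∑ i, ∑ j,
      ‖overlap hρ.isHermitian hσ.isHermitian j i‖ ^ 2 * (hρ.isHermitian.eigenvalues i *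
        Real.log (hρ.isHermitian.eigenvalues i)) := by
    have h := trace_cfc_mul_cfc hρ.isHermitian hσ.isHermitian (fun x => id x * Real.log x)
      (fun _ => 1)
    rw [cfc_const_one ℝ σ hσ.isHermitian.isSelfAdjoint, mul_one,
      cfc_mul id Real.log ρ (by fun_prop) (ρ.finite_real_spectrum.continuousOn _),
      cfc_id ℝ ρ hρ.isHermitian.isSelfAdjoint] at h
    simpa [mlog] using h
  rw [h2, h1]
  simp only [logSum, Finset.mul_sum, ← Finset.sum_sub_distrib]
  refine tendsto_finsetSum _ fun i _ => tendsto_finsetSum _ fun j _ => ?_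
  have hq := hσ.eigenvalues_nonneg j
  have hp := hρ.eigenvalues_nonneg i
  set p := hρ.isHermitian.eigenvalues i
  set q := hσ.isHermitian.eigenvalues j
  rcases hp.eq_or_lt with h0 | h0
  · simp [← h0]
  have hlim : Tendsto (fun T : ℝ => p + q / T) atTop (𝓝 p) := by
    simpa using tendsto_const_nhds.add (tendsto_const_nhds (x := q).div_atTop tendsto_id)
  have hlog := ((hlim.log h0.ne').const_mul p).const_mul
    (‖overlap hρ.isHermitian hσ.isHermitian j i‖ ^ 2)
  refine hlog.congr' ?_
  filter_upwards [eventually_gt_atTop 0] with T hT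
  have : T * p + q = T * (p + q / T) := by field_simp
  rw [this, Real.log_mul hT.ne' (by positivity)]
  ring

/-- If `supp ρ ≤ supp σ`, the eigenvectors of `ρ` with nonzero eigenvalue are orthogonal to the
kernel of `σ`. This keeps `logSum` continuous at `0`: a term whose logarithm blows up there has
coefficient zero. -/
theorem overlap_mul_eigenvalues_eq_zero {ρ σ : Matrix n n ℂ} (hρ : ρ.IsHermitian)
    (hσ : σ.IsHermitian) (hs : supp ρ ≤ supp σ) {i j : n} (hj : hσ.eigenvalues j = 0) :
    ‖overlap hρ hσ j i‖ ^ 2 * hρ.eigenvalues i = 0 := by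
  rw [supp_le_iff_forall_mul] at hs
  set U := (hρ.eigenvectorUnitary : Matrix n n ℂ) with hU
  set V := (hσ.eigenvectorUnitary : Matrix n n ℂ) with hV
  have hUU : Uᴴ * U = 1 := conjTranspose_mul_eigenvectorUnitary hρ
  have hVV : Vᴴ * V = 1 := conjTranspose_mul_eigenvectorUnitary hσ
  have eρ : ρ = U * Matrix.diagonal (fun i => (hρ.eigenvalues i : ℂ)) * Uᴴ := eq_mul_diagonal_mul hρ
  have eσ : σ = V * Matrix.diagonal (fun i => (hσ.eigenvalues i : ℂ)) * Vᴴ := eq_mul_diagonal_mul hσ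
  have h1 := hs (V * Matrix.single j j 1) (by
    conv_lhs => rw [eσ]
    rw [Matrix.mul_assoc, ← Matrix.mul_assoc Vᴴ, hVV, Matrix.one_mul, Matrix.mul_assoc]
    convert Matrix.mul_zero V
    ext k l
    rw [Matrix.diagonal_mul, Matrix.single_apply]
    split_ifs with h
    · simp [← h.1, hj]
    · simp)
  have h2 : Matrix.diagonal (fun i => (hρ.eigenvalues i : ℂ)) * ((overlap hρ hσ)ᴴ *
      Matrix.single j j 1) = 0 := by
    rw [conjTranspose_overlap, ← hU, ← hV, ← Matrix.mul_zero Uᴴ, ← h1]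
    conv_rhs => rw [eρ]
    simp only [← Matrix.mul_assoc, hUU, Matrix.one_mul]
  have h3 := congrFun (congrFun h2 i) j
  rw [Matrix.diagonal_mul, Matrix.mul_single_apply_same, Matrix.conjTranspose_apply] at h3
  rcases (by simpa using h3 : hρ.eigenvalues i = 0 ∨ overlap hρ hσ j i = 0) with h | h <;> simp [h]

theorem continuousOn_logSum {ρ σ : Matrix n n ℂ} (hρ : ρ.PosSemidef) (hσ : σ.PosSemidef)
    (hs : supp ρ ≤ supp σ) :
    ContinuousOn (logSum hρ.isHermitian hσ.isHermitian) (Ici 0) := by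
  refine continuousOn_finsetSum _ fun i _ => continuousOn_finsetSum _ fun j _ => ?_
  have hp := hρ.eigenvalues_nonneg i
  simp only [← mul_assoc]
  rcases (hσ.eigenvalues_nonneg j).eq_or_lt with h0 | h0
  · simp only [overlap_mul_eigenvalues_eq_zero hρ.isHermitian hσ.isHermitian hs h0.symm, zero_mul]
    exact continuousOn_const
  · refine continuousOn_const.mul (ContinuousOn.log (by fun_prop) fun T hT => ?_)
    have : 0 ≤ T := hT
    positivity

theorem hasDerivAt_logSum {ρ σ : Matrix n n ℂ} (hρ : ρ.PosSemidef) (hσ : σ.PosSemidef)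
    {T : ℝ} (hT : 0 < T) :
    HasDerivAt (logSum hρ.isHermitian hσ.isHermitian)
      (resolventSum T hρ.isHermitian hσ.isHermitian) T := by
  refine HasDerivAt.fun_sum fun i _ => HasDerivAt.fun_sum fun j _ => ?_
  have hp := hρ.eigenvalues_nonneg i
  have hq := hσ.eigenvalues_nonneg j
  set p := hρ.isHermitian.eigenvalues i
  set q := hσ.isHermitian.eigenvalues j
  refine HasDerivAt.const_mul _ ?_
  rcases hp.eq_or_lt with h0 | h0
  · simp only [← h0, zero_mul, ne_eq, OfNat.ofNat_ne_zero, not_false_eq_true, zero_pow, zero_div]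
    exact hasDerivAt_const _ _
  · have h1 : HasDerivAt (fun T : ℝ => T * p + q) p T := by
      simpa using ((hasDerivAt_id T).mul_const p).add_const q
    have h2 := (h1.log (by positivity)).const_mul p
    rwa [← mul_div_assoc, ← sq] at h2

/-- Monotonicity of the relative entropy under the adjoint of a unital `*`-homomorphism. The
difference of the two `logSum`s is monotone on `[0, ∞)`; the inequality compares its value at `0`
with its limit at `∞`. -/
theorem IsTraceDual.trace_mul_mlog_sub_le {ι : Matrix m m ℂ →⋆ₐ[ℂ] Matrix n n ℂ}
    {E : Matrix n n ℂ → Matrix m m ℂ} (h : IsTraceDual ι E) {ρ σ : Matrix n n ℂ}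
    (hρ : ρ.PosSemidef) (hσ : σ.PosSemidef) (hs : supp ρ ≤ supp σ) :
    (E ρ * mlog (E ρ)).trace.re - (E ρ * mlog (E σ)).trace.re ≤
      (ρ * mlog ρ).trace.re - (ρ * mlog σ).trace.re := by
  set D : ℝ → ℝ := fun T => logSum hρ.isHermitian hσ.isHermitian T -
    logSum (h.posSemidef hρ).isHermitian (h.posSemidef hσ).isHermitian T with hD
  have hmono : MonotoneOn D (Ici 0) := by
    refine monotoneOn_of_hasDerivWithinAt_nonneg (convex_Ici 0)
      ((continuousOn_logSum hρ hσ hs).sub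
        (continuousOn_logSum (h.posSemidef hρ) (h.posSemidef hσ)
          (h.supp_le_supp hρ hσ hs)))
      (f' := fun T => resolventSum T hρ.isHermitian hσ.isHermitian -
        resolventSum T (h.posSemidef hρ).isHermitian (h.posSemidef hσ).isHermitian) ?_ ?_
    · intro T hT
      rw [interior_Ici] at hT
      exact ((hasDerivAt_logSum hρ hσ hT).sub
        (hasDerivAt_logSum (h.posSemidef hρ) (h.posSemidef hσ) hT)).hasDerivWithinAt
    · intro T hT
      rw [interior_Ici] at hT
      exact sub_nonneg.2 (h.resolventSum_le hT hρ hσ)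
  have hlim : Tendsto D atTop
      (𝓝 ((ρ * mlog ρ).trace.re - (E ρ * mlog (E ρ)).trace.re)) := by
    -- the divergent terms cancel because `E` preserves the trace
    refine ((tendsto_logSum_sub hρ hσ).sub
      (tendsto_logSum_sub (h.posSemidef hρ) (h.posSemidef hσ))).congr fun T => ?_
    rw [h.trace_eq, hD]
    ring
  have h0 : D 0 = (ρ * mlog σ).trace.re - (E ρ * mlog (E σ)).trace.re := by
    simp only [hD, logSum_zero]
  have hle : D 0 ≤ (ρ * mlog ρ).trace.re - (E ρ * mlog (E ρ)).trace.re :=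
    ge_of_tendsto hlim ((eventually_ge_atTop 0).mono fun T hT =>
      hmono self_mem_Ici hT hT)
  linarith

end DataProcessing

/-! ### Partial traces -/

section PartialTrace

variable {a b c n : Type*} [Fintype a] [DecidableEq a] [Fintype b] [DecidableEq b]
  [Fintype c] [DecidableEq c] [Fintype n] [DecidableEq n]

/-- The embedding `X ↦ 1 ⊗ X` of the operators on the second factor of a tensor product. -/
def kroneckerOneHom (a n : Type*) [Fintype a] [DecidableEq a] [Fintype n] [DecidableEq n] :
    Matrix n n ℂ →⋆ₐ[ℂ] Matrix (a × n) (a × n) ℂ where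
  toFun X := (1 : Matrix a a ℂ) ⊗ₖ X
  map_one' := Matrix.one_kronecker_one
  map_mul' X Y := by rw [← Matrix.mul_kronecker_mul, Matrix.one_mul]
  map_zero' := Matrix.kronecker_zero _
  map_add' X Y := Matrix.kronecker_add _ _ _
  commutes' r := by
    rw [Algebra.algebraMap_eq_smul_one, Algebra.algebraMap_eq_smul_one, Matrix.kronecker_smul,
      Matrix.one_kronecker_one]
  map_star' X := by
    simp only [Matrix.star_eq_conjTranspose]
    rw [Matrix.conjTranspose_kronecker, Matrix.conjTranspose_one]

/-- The partial trace over the first factor of a tensor product. -/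
def traceFst (Y : Matrix (a × n) (a × n) ℂ) : Matrix n n ℂ :=
  Matrix.of fun p q => ∑ i, Y (i, p) (i, q)

theorem isTraceDual_traceFst :
    IsTraceDual (kroneckerOneHom a n) (traceFst : Matrix (a × n) (a × n) ℂ → Matrix n n ℂ) := by
  intro Y X
  change (Y * ((1 : Matrix a a ℂ) ⊗ₖ X)).trace = _
  simp only [Matrix.trace, Matrix.diag_apply, Matrix.mul_apply, Fintype.sum_prod_type,
    Matrix.kroneckerMap_apply, Matrix.one_apply, traceFst, Matrix.of_apply, Finset.sum_mul]
  calc _ = ∑ i, ∑ p, ∑ q, Y (i, p) (i, q) * X q p := by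
        refine Finset.sum_congr rfl fun i _ => Finset.sum_congr rfl fun p _ => ?_
        rw [Finset.sum_eq_single i (fun j _ hj => by simp [hj]) (by simp)]
        simp
    _ = _ := by
        rw [Finset.sum_comm]
        exact Finset.sum_congr rfl fun p _ => Finset.sum_comm

theorem isTraceDual_margBC :
    IsTraceDual (kroneckerOneHom a (b × c))
      (margBC : Matrix (a × b × c) (a × b × c) ℂ → Matrix (b × c) (b × c) ℂ) :=
  isTraceDual_traceFst

/-- The embedding of the operators on `AC` into those on `ABC`. -/
def extACHom (a b c : Type*) [Fintype a] [DecidableEq a] [Fintype b] [DecidableEq b]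
    [Fintype c] [DecidableEq c] :
    Matrix (a × c) (a × c) ℂ →⋆ₐ[ℂ] Matrix (a × b × c) (a × b × c) ℂ where
  toFun X := extAC b X
  map_one' := by
    ext p q
    simp only [extAC, Matrix.of_apply, Matrix.one_apply, Prod.ext_iff]
    grind
  map_mul' X Y := by
    ext p q
    simp only [extAC, Matrix.of_apply, Matrix.mul_apply, Fintype.sum_prod_type]
    have h : ∀ i, (∑ j, ∑ k, (if p.2.1 = j then X (p.1, p.2.2) (i, k) else 0) *
        (if j = q.2.1 then Y (i, k) (q.1, q.2.2) else 0)) =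
        if p.2.1 = q.2.1 then ∑ k, X (p.1, p.2.2) (i, k) * Y (i, k) (q.1, q.2.2) else 0 := by
      intro i
      rw [Finset.sum_eq_single p.2.1 (fun j _ hj => by simp [hj.symm]) (by simp)]
      simp only [if_true]
      split_ifs <;> simp
    rw [Finset.sum_congr rfl fun i _ => h i]
    split_ifs <;> simp
  map_zero' := by
    ext p q
    simp [extAC]
  map_add' X Y := by
    ext p q
    simp only [extAC, Matrix.of_apply, Matrix.add_apply]
    split_ifs <;> simp
  commutes' r := by
    ext p q
    simp only [extAC, Matrix.of_apply, Matrix.algebraMap_matrix_apply, Prod.ext_iff]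
    grind
  map_star' X := by
    ext p q
    simp only [extAC, Matrix.of_apply, Matrix.star_apply, eq_comm (a := p.2.1)]
    split_ifs <;> simp

theorem isTraceDual_margAC :
    IsTraceDual (extACHom a b c)
      (margAC : Matrix (a × b × c) (a × b × c) ℂ → Matrix (a × c) (a × c) ℂ) := by
  intro Y X
  change (Y * extAC b X).trace = _
  simp only [Matrix.trace, Matrix.diag_apply, Matrix.mul_apply, Fintype.sum_prod_type,
    extAC, Matrix.of_apply, margAC, Finset.sum_mul]
  refine Finset.sum_congr rfl fun i _ => ?_
  calc _ = ∑ j, ∑ k, ∑ i', ∑ k', Y (i, j, k) (i', j, k') * X (i', k') (i, k) := by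
        refine Finset.sum_congr rfl fun j _ => Finset.sum_congr rfl fun k _ =>
          Finset.sum_congr rfl fun i' _ => ?_
        rw [Finset.sum_eq_single j (fun j' _ hj => by simp [hj]) (by simp)]
        simp
    _ = _ := by
        rw [Finset.sum_comm]
        refine Finset.sum_congr rfl fun k _ => ?_
        rw [Finset.sum_comm]
        exact Finset.sum_congr rfl fun i' _ => Finset.sum_comm

theorem margC_eq_traceFst_margBC {a b c : Type*} [Fintype a] [Fintype b]
    (Y : Matrix (a × b × c) (a × b × c) ℂ) :
    margC Y = traceFst (margBC Y) := by
  ext p q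
  exact Finset.sum_comm

theorem margC_eq_traceFst_margAC {a b c : Type*} [Fintype a] [Fintype b]
    (Y : Matrix (a × b × c) (a × b × c) ℂ) :
    margC Y = traceFst (margAC Y) := rfl

theorem trace_mul_extC (Y : Matrix (a × b × c) (a × b × c) ℂ) (X : Matrix c c ℂ) :
    (Y * extC a b X).trace = (margC Y * X).trace := by
  rw [margC_eq_traceFst_margBC, ← isTraceDual_traceFst, ← isTraceDual_margBC]
  rfl

/-! ### The logarithm of `expLogComb` -/

theorem isHermitian_mlog (X : Matrix n n ℂ) : (mlog X).IsHermitian :=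
  cfc_predicate Real.log X

theorem isHermitian_map {m : Type*} [Fintype m] [DecidableEq m]
    (ι : Matrix m m ℂ →⋆ₐ[ℂ] Matrix n n ℂ) {X : Matrix m m ℂ} (hX : X.IsHermitian) :
    (ι X).IsHermitian := by
  rw [Matrix.IsHermitian, ← Matrix.star_eq_conjTranspose, ← map_star,
    Matrix.star_eq_conjTranspose, hX.eq]

/-- On states supported in the domain of `expLogComb σ`, the expectation of its logarithm is a
combination of expectations on the marginals. -/
theorem trace_mul_mlog_expLogComb {ρ σ : Matrix (a × b × c) (a × b × c) ℂ} (hρ : ρ.IsHermitian)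
    (hs : supp ρ ≤ supp (extAC b (margAC σ)) ⊓ supp (extBC a (margBC σ))) :
    (ρ * mlog (expLogComb σ)).trace =
      (margAC ρ * mlog (margAC σ)).trace + (margBC ρ * mlog (margBC σ)).trace -
        (margC ρ * mlog (margC σ)).trace := by
  set V := supp (extAC b (margAC σ)) ⊓ supp (extBC a (margBC σ)) with hV
  have hH : (extAC b (mlog (margAC σ)) + extBC a (mlog (margBC σ)) -
      extC a b (mlog (margC σ))).IsHermitian :=
    ((isHermitian_map (extACHom a b c) (isHermitian_mlog _)).add
      (isHermitian_map (kroneckerOneHom a (b × c)) (isHermitian_mlog _))).sub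
      (isHermitian_map (kroneckerOneHom a (b × c))
        (isHermitian_map (kroneckerOneHom b c) (isHermitian_mlog _)))
  have hρP : ρ * projMatrix V = ρ := (supp_le_iff_mul_projMatrix ρ V).1 hs
  have hPρ : projMatrix V * ρ = ρ := by
    simpa [Matrix.conjTranspose_mul, isHermitian_projMatrix, hρ.eq]
      using congrArg Matrix.conjTranspose hρP
  rw [expLogComb, ← hV, mlog_expOn V hH, ← Matrix.mul_assoc, ← Matrix.mul_assoc, hρP,
    Matrix.trace_mul_comm, ← Matrix.mul_assoc, hPρ, Matrix.mul_sub, Matrix.mul_add,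
    Matrix.trace_sub, Matrix.trace_add, trace_mul_extC]
  exact congrArg₂ _ (congrArg₂ _ (isTraceDual_margAC _ _) (isTraceDual_margBC _ _)) rfl

end PartialTrace

end QEntropy

theorem mainTheorem1 {a b c : Type*} [Fintype a] [DecidableEq a] [Fintype b] [DecidableEq b]
    [Fintype c] [DecidableEq c] (ρ σ : Matrix (a × b × c) (a × b × c) ℂ)
    (hρ : QEntropy.IsState ρ) (hσ : QEntropy.IsState σ) :
    QEntropy.relEntropy ρ (QEntropy.expLogComb σ) ≥
      (QEntropy.condMutualInfo ρ : EReal)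
        + ((1 / 2 : ℝ) : EReal) * QEntropy.relEntropy (QEntropy.margAC ρ) (QEntropy.margAC σ)
        + ((1 / 2 : ℝ) : EReal) * QEntropy.relEntropy (QEntropy.margBC ρ) (QEntropy.margBC σ) := by
  open QEntropy in
  by_cases hs : supp ρ ≤ supp (expLogComb σ)
  swap
  · rw [relEntropy, if_neg hs]
    exact le_top
  have hV := hs.trans (supp_expOn_le _ _)
  have hρ0 := hρ.posSemidef
  have hσ0 := hσ.posSemidef
  have hAC : supp (margAC ρ) ≤ supp (margAC σ) :=
    isTraceDual_margAC.supp_le_of_supp_le_map hρ0 (hV.trans inf_le_left)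
  have hBC : supp (margBC ρ) ≤ supp (margBC σ) :=
    isTraceDual_margBC.supp_le_of_supp_le_map hρ0 (hV.trans inf_le_right)
  have h1 := isTraceDual_traceFst.trace_mul_mlog_sub_le (isTraceDual_margAC.posSemidef hρ0)
    (isTraceDual_margAC.posSemidef hσ0) hAC
  have h2 := isTraceDual_traceFst.trace_mul_mlog_sub_le (isTraceDual_margBC.posSemidef hρ0)
    (isTraceDual_margBC.posSemidef hσ0) hBC
  rw [← margC_eq_traceFst_margAC, ← margC_eq_traceFst_margAC] at h1
  rw [← margC_eq_traceFst_margBC, ← margC_eq_traceFst_margBC] at h2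
  have h3 := congrArg Complex.re (trace_mul_mlog_expLogComb hρ0.isHermitian hV)
  simp only [Complex.add_re, Complex.sub_re] at h3
  rw [relEntropy, relEntropy, relEntropy, if_pos hs, if_pos hAC, if_pos hBC, ge_iff_le]
  norm_cast
  simp only [condMutualInfo, entropy, Matrix.mul_sub, Matrix.trace_sub, Complex.sub_re]
  linarith
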